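/- \textbf{Conventions.} Let $\tau$ be a finitary vocabulary (a set of relation and function symbols of finite arity). A $\tau$-structure $M$ has a universe $UM$ (a set); its cardinality is $|UM|$. For $\tau$-structures $M, N$ we write $M \subseteq N$ if $UM \subseteq UN$ and the inclusion map is a homomorphism. For an injective map $f$ defined on $UM$, $f[M]$ is the structure with universe $f[UM]$ for which $f : M \to f[M]$ is an isomorphism. An \emph{abstract elementary class} (AEC) $\mathbf{K} = (K, \le_{\mathbf{K}})$ consists of a finitary vocabulary $\tau$, a class $K$ of $\tau$-structures and a partial order $\le_{\mathbf{K}}$ on $K$ such that: (1) $K$ is closed under isomorphisms; $M \le_{\mathbf{K}} N$ implies $M \subseteq N$; and if $M \le_{\mathbf{K}} N$ and $f : N \cong N'$, then $f[M] \le_{\mathbf{K}} N'$; (2) if $M_0, M_1, M_2 \in K$, $UM_0 \subseteq UM_1$, $M_1 \le_{\mathbf{K}} M_2$ and $M_0 \le_{\mathbf{K}} M_2$, then $M_0 \le_{\mathbf{K}} M_1$; (3) if $I$ is a (nonempty) directed poset, $M_i \in K$ for $i \in I$, and $M_i \le_{\mathbf{K}} M_j$ whenever $i \le j$, then $M :=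 \bigcup_{i \in I} M_i$ is in $K$, $M_i \le_{\mathbf{K}} M$ for all $i \in I$, and whenever $N \in K$ satisfies $M_i \le_{\mathbf{K}} N$ for all $i \in I$, then $M \le_{\mathbf{K}} N$; (4) there is a cardinal $\kappa \ge |\tau| + \aleph_0$ such that for all $M \in K$ and all $A \subseteq UM$ there is $M_0 \in K$ with $M_0 \le_{\mathbf{K}} M$, $A \subseteq UM_0$ and $|UM_0| \le |A| + \kappa$. The least such $\kappa$ is denoted $\mathrm{LS}(\mathbf{K})$. A \emph{$\mathbf{K}$-embedding} $f : M \to N$ (where $M, N \in K$) is an injective homomorphism such that $f[M] \le_{\mathbf{K}} N$. For a cardinal $\lambda$, $\mathbf{K}_\lambda$ (resp. $\mathbf{K}_{<\lambda}$) is the class of members of $K$ of cardinality $\lambda$ (resp. $< \lambda$). A model $N \in \mathbf{K}_\lambda$ is \emph{universal} in $\mathbf{K}_\lambda$ if for every $M \in \mathbf{K}_\lambda$ there is a $\mathbf{K}$-embedding $M \to N$. A model $A \in \mathbf{K}_{<\lambda}$ is an \emph{amalgamation base in $\mathbf{K}_{<\lambda}$} if for all $B, C \in \mathbf{K}_{<\lambda}$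 and all $\mathbf{K}$-embeddings $f : A \to B$ and $g : A \to C$ there are $D \in \mathbf{K}_{<\lambda}$ and $\mathbf{K}$-embeddings $f' : B \to D$ and $g' : C \to D$ with $f' f = g' g$. Finally, $2^{<\lambda} = \sup_{\mu < \lambda} 2^{\mu}$, for $\mu$ ranging over cardinals. \textbf{Theorem.} Let $\mathbf{K}$ be an AEC and let $\lambda > \mathrm{LS}(\mathbf{K})$ be a cardinal such that there exists a cardinal $\theta < \lambda$ with $2^{\theta} = 2^{<\lambda} < 2^{\lambda}$. If there exists a universal model in $\mathbf{K}_\lambda$, then for every $M \in \mathbf{K}_{<\lambda}$ there exists $N \in \mathbf{K}_{<\lambda}$ such that $M \le_{\mathbf{K}} N$ and $N$ is an amalgamation base in $\mathbf{K}_{<\lambda}$. -/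

import Mathlib

open Cardinal FirstOrder

universe w

/-- A `τ`-structure in the set-theoretic sense: its universe is a (possibly empty) set `U`,
and it interprets every function and relation symbol of the finitary vocabulary `τ` on `U`. -/
structure Str (τ : FirstOrder.Language.{w, w}) where
  /-- the universe of the structure -/
  U : ZFSet.{w}
  /-- the interpretations of the symbols -/
  [str : τ.Structure U]

namespace Str

variable {τ : FirstOrder.Language.{w, w}}

instance : CoeSort (Str τ) (Type (w + 1)) := ⟨fun M => M.U⟩

instance instStructure (M : Str τ) : τ.Structure M := M.str

/-- The cardinality of the universe of a structure. -/
noncomputable def card (M : Str τ) : Cardinal.{w} := M.U.card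

/-- `M ⊆ N`: the universe of `M` is contained in that of `N` and the inclusion map is a
homomorphism of `τ`-structures. -/
def IsSub (M N : Str τ) : Prop :=
  M.U ⊆ N.U ∧ ∃ φ : M →[τ] N, ∀ x : M, (φ x : ZFSet.{w}) = x

/-- The copy `f[M]` of `M` along an injective map `f` defined on the universe of `M`: its universe
is the range of `f`, and its structure is the one that makes `f : M → f[M]` an isomorphism. -/
noncomputable def image (M : Str τ) (f : M → ZFSet.{w}) (hf : Function.Injective f) : Str τ where
  U := ZFSet.range f
  str := Equiv.inducedStructure
    ((Equiv.ofInjective f hf).trans (Equiv.setCongr (ZFSet.coe_range f).symm))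

/-- `N` is the union of the structures `M i`: its universe is the union of their universes, each
`M i` is a substructure of it (for a directed system this determines the functions of `N`), and
its relations are the unions of their relations. -/
structure IsUnion {I : Type w} (M : I → Str τ) (N : Str τ) : Prop where
  mem_iff : ∀ x : ZFSet.{w}, x ∈ N.U ↔ ∃ i, x ∈ (M i).U
  isSub : ∀ i, (M i).IsSub N
  rel : ∀ {n : ℕ} (r : τ.Relations n) (x : Fin n → N), FirstOrder.Language.Structure.RelMap r x →
    ∃ (i : I) (y : Fin n → M i), (∀ k, (y k : ZFSet.{w}) = x k) ∧
      FirstOrder.Language.Structure.RelMap r y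

end Str

/-- The data of an abstract class: a class `mem` of `τ`-structures and a relation `le` on
`τ`-structures. -/
structure ClassData (τ : FirstOrder.Language.{w, w}) where
  /-- membership in the class -/
  mem : Str τ → Prop
  /-- the strong substructure relation of the class -/
  le : Str τ → Str τ → Prop

/-- The infinite cardinal `κ ≥ |τ|` is such that every subset `A` of the universe of a member `M`
of the class is contained in some `M₀ ≤ M` of cardinality at most `|A| + κ`. (For finitary
vocabularies `κ = κ ^ (< ℵ₀)` is automatic, and `|A| ^ (< ℵ₀) + κ = |A| + κ`.) -/
def ClassData.IsLST {τ : FirstOrder.Language.{w, w}} (K : ClassData τ) (κ : Cardinal.{w}) : Prop :=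
  τ.card + ℵ₀ ≤ κ ∧
    ∀ M : Str τ, K.mem M → ∀ A : ZFSet.{w}, A ⊆ M.U →
      ∃ M₀ : Str τ, K.mem M₀ ∧ K.le M₀ M ∧ A ⊆ M₀.U ∧ M₀.card ≤ A.card + κ

/-- Abstract elementary classes in the (finitary) vocabulary `τ`. -/
structure AEC (τ : FirstOrder.Language.{w, w}) extends ClassData τ where
  /-- `le` is a relation on the class -/
  mem_of_le : ∀ {M N : Str τ}, le M N → mem M ∧ mem N
  /-- `le` is a partial order on the class -/
  le_refl : ∀ {M : Str τ}, mem M → le M M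
  le_trans : ∀ {M N P : Str τ}, le M N → le N P → le M P
  le_antisymm : ∀ {M N : Str τ}, le M N → le N M → M = N
  /-- the class is closed under isomorphisms -/
  mem_of_equiv : ∀ {M N : Str τ}, mem M → (M ≃[τ] N) → mem N
  /-- `le` refines the substructure relation -/
  isSub_of_le : ∀ {M N : Str τ}, le M N → M.IsSub N
  /-- `le` respects isomorphisms: if `M ≤ N` and `f : N ≅ N'`, then `f[M] ≤ N'` -/
  le_image : ∀ {M N N' : Str τ}, le M N → ∀ (h : M.U ⊆ N.U) (f : N ≃[τ] N'),
    le (M.image (fun x => (f ⟨x, h x.2⟩ : ZFSet.{w}))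
      (fun _ _ hxy => Subtype.ext
        (congrArg (fun y : N => (y : ZFSet.{w})) (f.injective (Subtype.ext hxy))))) N'
  /-- coherence -/
  coherence : ∀ {M₀ M₁ M₂ : Str τ}, mem M₀ → mem M₁ → mem M₂ →
    M₀.U ⊆ M₁.U → le M₁ M₂ → le M₀ M₂ → le M₀ M₁
  /-- the Tarski-Vaught axiom for directed systems -/
  tarski_vaught : ∀ {I : Type w} [PartialOrder I] [Nonempty I] [IsDirected I (· ≤ ·)]
    (M : I → Str τ), (∀ i, mem (M i)) → (∀ i j, i ≤ j → le (M i) (M j)) →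
    ∀ N : Str τ, Str.IsUnion M N →
      mem N ∧ (∀ i, le (M i) N) ∧ ∀ P : Str τ, mem P → (∀ i, le (M i) P) → le N P
  /-- the Löwenheim-Skolem-Tarski axiom -/
  exists_isLST : ∃ κ : Cardinal.{w}, toClassData.IsLST κ

namespace AEC

variable {τ : FirstOrder.Language.{w, w}} (K : AEC τ)

/-- The Löwenheim-Skolem-Tarski number `LS(K)`. -/
noncomputable def LS : Cardinal.{w} := sInf {κ | K.IsLST κ}

/-- A homomorphism `f : M → N` is a `K`-embedding if it is injective and `f[M] ≤ N`. -/
def IsEmb {M N : Str τ} (f : M →[τ] N) : Prop :=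
  ∃ hf : Function.Injective f,
    K.le (M.image (fun x => (f x : ZFSet.{w})) (Subtype.val_injective.comp hf)) N

/-- `M` belongs to `K_lam`, the members of `K` of cardinality `lam`. -/
def MemEq (lam : Cardinal.{w}) (M : Str τ) : Prop := K.mem M ∧ M.card = lam

/-- `M` belongs to `K_{<lam}`, the members of `K` of cardinality less than `lam`. -/
def MemLT (lam : Cardinal.{w}) (M : Str τ) : Prop := K.mem M ∧ M.card < lam

/-- `N` is a universal model in `K_lam`. -/
def IsUniversal (lam : Cardinal.{w}) (N : Str τ) : Prop :=
  K.MemEq lam N ∧ ∀ M : Str τ, K.MemEq lam M → ∃ f : M →[τ] N, K.IsEmb f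

/-- `A` is an amalgamation base of the category `K_{<lam}` (with the `K`-embeddings as morphisms):
every span `B ← A → C` in `K_{<lam}` can be completed to a commutative square in `K_{<lam}`. -/
def IsAmalgamationBase (lam : Cardinal.{w}) (A : Str τ) : Prop :=
  K.MemLT lam A ∧
    ∀ (B C : Str τ) (f : A →[τ] B) (g : A →[τ] C), K.MemLT lam B → K.MemLT lam C →
      K.IsEmb f → K.IsEmb g →
      ∃ (D : Str τ) (f' : B →[τ] D) (g' : C →[τ] D), K.MemLT lam D ∧
        K.IsEmb f' ∧ K.IsEmb g' ∧ f'.comp f = g'.comp g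

end AEC

/-! Suppose no small extension of `M` is an amalgamation base. Then a binary tree of models of
height `lam.ord` grows from `M`, each node having two successors that cannot be amalgamated over it.
Every branch `η` ends in a model of size `lam`, which has an embedding `f η` into the universal
model `N`.

Let the code of `η` at `δ` be the path up to `δ` with the restriction of `f η` to the node there. As
`lam ≤ 2 ^< lam = 2 ^ θ`, each height has at most `2 ^ θ` codes (`mk_sigma_tree_le`). Equal codes at
`δ` force equal bits at `δ`: otherwise `N`, cut down by Löwenheim-Skolem, would amalgamate a split
(`IsSplit.false_of_isEmb`). Codes are also continuous at limits.

Such a coding yields `2 ^ lam ≤ 2 ^ θ` (`two_power_le_of_predictor`), a contradiction. The reason: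
the code at `δ` predicts one bit, and a new branch can be formed whose bits are the codes of the old
one at the next height. Iterating `ω` times, the codes at height 0 of all these branches determine
every later code, hence `η`. -/

/-! ### Predictors and cardinal arithmetic -/

/-- Iterated self-coding of a predictor `c`: the `n`-th row is a family of branches indexed by `Θ`,
and the values of the `(n + 1)`-st row at `δ` record the codes of the `n`-th row at `δ + 1`. -/
def codingRow {Θ : Type w} (e : Θ ≃ Θ × Θ) (c : (Ordinal.{w} → Bool) → Ordinal.{w} → Θ → Bool)
    (η : Ordinal.{w} → Bool) : ℕ → Θ → Ordinal.{w} → Bool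
  | 0 => fun _ => η
  | n + 1 => fun i δ => c (codingRow e c η n (e i).1) (δ + 1) (e i).2

/-- If the codes `c η δ` in `2 ^ Θ` are continuous in `δ` and determine the bits `η δ`, then there
are at most `2 ^ #Θ` branches of height `lam`. -/
theorem two_power_le_of_predictor {Θ : Type w} [Infinite Θ] {lam : Cardinal.{w}} (hlam : ℵ₀ ≤ lam)
    (c : (Ordinal.{w} → Bool) → Ordinal.{w} → Θ → Bool)
    (hdet : ∀ η ν δ, δ < lam.ord → c η δ = c ν δ → η δ = ν δ)
    (hlim : ∀ η ν δ, δ < lam.ord → Order.IsSuccLimit δ → (∀ α < δ, c η α = c ν α) →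
      c η δ = c ν δ) :
    (2 : Cardinal.{w}) ^ lam ≤ 2 ^ #Θ := by
  have hΘ : #Θ = #(Θ × Θ) := by
    rw [Cardinal.mk_prod, Cardinal.lift_id, Cardinal.mul_eq_self (Cardinal.aleph0_le_mk Θ)]
  obtain ⟨e⟩ := Cardinal.eq.1 hΘ
  have hsucc : Order.IsSuccLimit lam.ord := Cardinal.isSuccLimit_ord hlam
  have key : ∀ η ν : Ordinal.{w} → Bool,
      (∀ n i, c (codingRow e c η n i) 0 = c (codingRow e c ν n i) 0) →
      ∀ δ < lam.ord, ∀ n i, c (codingRow e c η n i) δ = c (codingRow e c ν n i) δ := by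
    intro η ν h0 δ
    induction δ using Ordinal.limitRecOn with
    | zero => intro _ n i; exact h0 n i
    | add_one δ ih =>
      intro hδ n i
      have hδ' : δ < lam.ord := (lt_add_one δ).trans hδ
      funext j
      -- Bit `δ` of row `n + 1` at index `e.symm (i, j)` is bit `j` of the code of row `n`, index
      -- `i`, at `δ + 1`. The induction therefore has to treat all rows at once.
      have := hdet _ _ δ hδ' (ih hδ' (n + 1) (e.symm (i, j)))
      simpa [codingRow] using this
    | limit δ hδ ih =>
      intro hlt n i
      exact hlim _ _ δ hlt hδ fun α hα => ih α hα (hα.trans hlt) n i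
  let ext : (lam.ord.ToType → Bool) → Ordinal.{w} → Bool := fun f α =>
    if h : α < lam.ord then f (Ordinal.ToType.mk ⟨α, h⟩) else false
  let F : (lam.ord.ToType → Bool) → (ℕ × Θ × Θ → Bool) := fun f p =>
    c (codingRow e c (ext f) p.1 p.2.1) 0 p.2.2
  have hF : Function.Injective F := by
    intro f g hfg
    have h := key (ext f) (ext g) fun n i => funext fun j => congrFun hfg (n, i, j)
    funext x
    obtain ⟨⟨α, hα⟩, rfl⟩ := Ordinal.ToType.mk.surjective x
    have hα' : α < lam.ord := hα
    have := hdet _ _ α hα' (h α hα' 0 (Classical.arbitrary Θ))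
    simpa [codingRow, ext, hα'] using this
  have hcard := Cardinal.mk_le_of_injective hF
  have hn : (ℵ₀ : Cardinal.{w}) * #Θ = #Θ :=
    Cardinal.aleph0_mul_eq (Cardinal.aleph0_le_mk Θ)
  simpa [← hΘ, Cardinal.mul_eq_self (Cardinal.aleph0_le_mk Θ), hn] using hcard

/-- If `2 ^ θ = 2 ^< lam < 2 ^ lam` for some `θ < lam`, then `lam` is regular. -/
theorem isRegular_of_two_power_eq_powerlt {lam θ : Cardinal.{w}} (hlam : ℵ₀ ≤ lam) (hθ : θ < lam)
    (h1 : (2 : Cardinal.{w}) ^ θ = 2 ^< lam) (h2 : (2 : Cardinal.{w}) ^< lam < 2 ^ lam) :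
    lam.IsRegular := by
  refine ⟨hlam, ?_⟩
  by_contra! hcof
  rw [← Ordinal.cof_toType] at hcof
  obtain ⟨s, hs, hsc⟩ := Order.exists_cof_eq lam.ord.ToType
  have hb : ∀ a : s, Nonempty ((Set.Iic (a : lam.ord.ToType) → Bool) ↪ (θ.out → Bool)) := by
    intro a
    rw [← Cardinal.le_def]
    have ha : #(Set.Iic (a : lam.ord.ToType)) < lam := by
      simpa using Cardinal.mk_Iic_lt (a : lam.ord.ToType) (by simp) (by simpa using hlam)
    calc #(Set.Iic (a : lam.ord.ToType) → Bool) = 2 ^ #(Set.Iic (a : lam.ord.ToType)) := by simp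
      _ ≤ 2 ^< lam := Cardinal.le_powerlt _ ha
      _ = #(θ.out → Bool) := by simp [← h1]
  let E := fun a => (hb a).some
  -- A function on a singular `lam` is determined by its restrictions to fewer than `lam` initial
  -- segments, each coded by `θ` bits.
  let F : (lam.ord.ToType → Bool) → (s × θ.out → Bool) := fun f p => E p.1 (fun x => f x) p.2
  have hF : Function.Injective F := by
    intro f g hfg
    funext x
    obtain ⟨a, ha, hxa⟩ := hs x
    have : (fun y : Set.Iic a => f y) = fun y : Set.Iic a => g y :=
      (E ⟨a, ha⟩).injective (funext fun t => congrFun hfg (⟨a, ha⟩, t))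
    exact congrFun this ⟨x, hxa⟩
  have hcard := Cardinal.mk_le_of_injective hF
  have hmul : #s * θ < lam := Cardinal.mul_lt_of_lt hlam (hsc ▸ hcof) hθ
  have : (2 : Cardinal.{w}) ^ lam ≤ 2 ^ (#s * θ) := by simpa using hcard
  exact (this.trans (Cardinal.le_powerlt _ hmul)).not_gt h2

theorem le_two_powerlt (lam : Cardinal.{w}) : lam ≤ 2 ^< lam := by
  by_contra! h
  exact (Cardinal.le_powerlt (2 : Cardinal.{w}) h).not_gt (Cardinal.cantor _)

/-- For finite `θ` the left side is finite, whereas `2 ^< lam` is at least `2 ^ ℵ₀`. -/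
theorem aleph0_le_of_two_power_eq_powerlt {lam θ : Cardinal.{w}} (hlam : ℵ₀ < lam)
    (h1 : (2 : Cardinal.{w}) ^ θ = 2 ^< lam) : ℵ₀ ≤ θ := by
  by_contra! h
  have h3 : (2 : Cardinal.{w}) ^ θ < ℵ₀ := Cardinal.power_lt_aleph0 Cardinal.natCast_lt_aleph0 h
  exact ((Cardinal.cantor ℵ₀).le.trans ((Cardinal.le_powerlt _ hlam).trans_eq h1.symm)).not_gt h3

/-! ### Isomorphic copies and directed unions of structures -/

namespace Str

variable {τ : FirstOrder.Language.{w, w}}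

theorem structure_eq_of_equiv {U : Type*} {s t : τ.Structure U}
    (e : @Language.Equiv τ U U s t) (he : ∀ x, e x = x) : s = t := by
  have hx : ∀ {n : ℕ} (x : Fin n → U), (⇑e ∘ x) = x := fun x => funext fun k => he (x k)
  apply Language.Structure.ext
  · funext n f x
    have h := @Language.Equiv.map_fun τ U U s t e n f x
    rw [hx, he] at h
    exact h
  · funext n r x
    have h := @Language.Equiv.map_rel τ U U s t e n r x
    rw [hx] at h
    exact propext h.symm

/-- Two structures on the same universe for which the identity is an isomorphism are equal. -/
theorem eq_of_equiv {M N : Str τ} (e : M ≃[τ] N) (he : ∀ x : M, (e x : ZFSet.{w}) = x) : M = N := by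
  have hU : M.U = N.U := by
    ext x
    constructor
    · intro hx
      have := (e ⟨x, hx⟩).2
      rwa [he] at this
    · intro hx
      obtain ⟨y, hy⟩ := e.surjective ⟨x, hx⟩
      have h1 := he y
      rw [hy] at h1
      have h2 : x = y := h1
      exact h2 ▸ y.2
  obtain @⟨U, s⟩ := M
  obtain @⟨V, t⟩ := N
  obtain rfl : U = V := hU
  have h : s = t := structure_eq_of_equiv e fun x => Subtype.ext (he x)
  rw [h]

/-- The isomorphism of a structure with its copy along an injective map. -/
noncomputable def imageEquiv (M : Str τ) (f : M → ZFSet.{w}) (hf : Function.Injective f) :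
    M ≃[τ] M.image f hf :=
  Equiv.inducedStructureEquiv
    ((Equiv.ofInjective f hf).trans (Equiv.setCongr (ZFSet.coe_range f).symm))

@[simp]
theorem imageEquiv_apply (M : Str τ) (f : M → ZFSet.{w}) (hf : Function.Injective f) (x : M) :
    (M.imageEquiv f hf x : ZFSet.{w}) = f x := rfl

theorem eq_image {M N : Str τ} (f : M → ZFSet.{w}) (hf : Function.Injective f) (e : M ≃[τ] N)
    (he : ∀ x : M, (e x : ZFSet.{w}) = f x) : M.image f hf = N :=
  eq_of_equiv (e.comp (M.imageEquiv f hf).symm) fun x => by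
    obtain ⟨y, rfl⟩ := (M.imageEquiv f hf).surjective x
    simp [he]

theorem card_eq_of_equiv {M N : Str τ} (e : M ≃[τ] N) : M.card = N.card := by
  rw [card, card, ← Cardinal.lift_inj.{w, w + 1}, ← ZFSet.cardinalMk_coe_sort,
    ← ZFSet.cardinalMk_coe_sort]
  exact Cardinal.mk_congr e.toEquiv

/-- A homomorphic inclusion of structures. -/
noncomputable def IsSub.hom {M N : Str τ} (h : M.IsSub N) : M →[τ] N := h.2.choose

@[simp]
theorem IsSub.coe_hom {M N : Str τ} (h : M.IsSub N) (x : M) : (h.hom x : ZFSet.{w}) = x :=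
  h.2.choose_spec x

/-- A directed system of structures has a union. -/
theorem exists_isUnion {I : Type w} [PartialOrder I] [Nonempty I] [IsDirected I (· ≤ ·)]
    (M : I → Str τ) (hM : ∀ i j, i ≤ j → (M i).IsSub (M j)) : ∃ N, IsUnion M N := by
  classical
  have bound : ∀ {n : ℕ} (x : Fin n → (ZFSet.iUnion fun i => (M i).U : ZFSet.{w})),
      ∃ (i : I) (y : Fin n → M i), ∀ k, (y k : ZFSet.{w}) = x k := by
    intro n x
    choose j hj using fun k => ZFSet.mem_iUnion.1 (x k).2
    obtain ⟨i, hi⟩ := Finset.exists_le (Finset.univ.image j)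
    have hi' : ∀ k, j k ≤ i := fun k => hi _ (Finset.mem_image_of_mem _ (Finset.mem_univ k))
    exact ⟨i, fun k => ⟨x k, (hM _ _ (hi' k)).1 (hj k)⟩, fun k => rfl⟩
  -- Directedness makes the value of a function symbol independent of the index chosen to contain
  -- its arguments.
  have agree : ∀ {n : ℕ} (f : τ.Functions n) (i j : I) (y : Fin n → M i) (z : Fin n → M j),
      (∀ k, (y k : ZFSet.{w}) = z k) →
      ((Language.Structure.funMap f y : M i) : ZFSet.{w}) = (Language.Structure.funMap f z : M j) := by
    intro n f i j y z hyz
    obtain ⟨k, hik, hjk⟩ := directed_of (· ≤ ·) i j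
    have h1 := (hM i k hik).coe_hom (Language.Structure.funMap f y)
    have h2 := (hM j k hjk).coe_hom (Language.Structure.funMap f z)
    rw [Language.Hom.map_fun] at h1 h2
    have h3 : (⇑(hM i k hik).hom ∘ y) = ⇑(hM j k hjk).hom ∘ z :=
      funext fun l => Subtype.ext (by simp [hyz])
    rw [← h1, ← h2, h3]
  choose ix arg harg using @bound
  have hsub : ∀ i, (M i).U ⊆ ZFSet.iUnion fun i => (M i).U :=
    fun i x hx => ZFSet.mem_iUnion.2 ⟨i, hx⟩
  let S : τ.Structure (ZFSet.iUnion fun i => (M i).U : ZFSet.{w}) :=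
    { funMap := fun {n} f x => ⟨(Language.Structure.funMap f (arg x) : M (ix x)),
        hsub _ (Language.Structure.funMap f (arg x) : M (ix x)).2⟩
      RelMap := fun {n} r x => ∃ (i : I) (y : Fin n → M i), (∀ k, (y k : ZFSet.{w}) = x k) ∧
        Language.Structure.RelMap r y }
  refine ⟨@Str.mk τ _ S, ⟨fun x => ZFSet.mem_iUnion, fun i => ⟨hsub i, ?_⟩, fun r x h => h⟩⟩
  refine ⟨⟨fun x => ⟨x, hsub i x.2⟩, fun {n} f x => ?_, fun {n} r x h => ⟨i, x, fun k => rfl, h⟩⟩,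
    fun x => rfl⟩
  exact Subtype.ext (agree f _ _ _ _ fun k => (harg (fun k => ⟨x k, hsub i (x k).2⟩) k).symm)

end Str

/-! ### Embeddings and splits -/

namespace AEC

variable {τ : FirstOrder.Language.{w, w}} (K : AEC τ)

theorem exists_le_of_equiv {M N N' : Str τ} (h : K.le M N) (f : N ≃[τ] N') :
    ∃ (M' : Str τ) (e : M ≃[τ] M'), K.le M' N' ∧
      ∀ (x : M) (hx : (x : ZFSet.{w}) ∈ N.U), (e x : ZFSet.{w}) = f ⟨x, hx⟩ :=
  ⟨_, M.imageEquiv _ _, K.le_image h (K.isSub_of_le h).1 f, fun _ _ => rfl⟩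

theorem isEmb_iff {M N : Str τ} (f : M →[τ] N) :
    K.IsEmb f ↔ ∃ (M' : Str τ) (e : M ≃[τ] M'), K.le M' N ∧ ∀ x, (e x : ZFSet.{w}) = f x := by
  constructor
  · rintro ⟨hf, h⟩
    exact ⟨_, M.imageEquiv _ _, h, fun _ => rfl⟩
  · rintro ⟨M', e, h, he⟩
    have hf : Function.Injective f := fun x y hxy =>
      e.injective (Subtype.ext (by rw [he, he, hxy]))
    refine ⟨hf, ?_⟩
    rwa [Str.eq_image _ _ e he]

variable {K}

theorem mem_left {M N : Str τ} (h : K.le M N) : K.mem M := (K.mem_of_le h).1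

theorem mem_right {M N : Str τ} (h : K.le M N) : K.mem N := (K.mem_of_le h).2

/-- The inclusion of `M` in `N` when `M ≤ N`. -/
noncomputable def incl {M N : Str τ} (h : K.le M N) : M →[τ] N := (K.isSub_of_le h).hom

@[simp]
theorem coe_incl {M N : Str τ} (h : K.le M N) (x : M) : (incl h x : ZFSet.{w}) = x :=
  (K.isSub_of_le h).coe_hom x

theorem isEmb_incl {M N : Str τ} (h : K.le M N) : K.IsEmb (incl h) :=
  (K.isEmb_iff _).2 ⟨M, Language.Equiv.refl τ M, h, fun x => by simp⟩

theorem IsEmb.comp {M N P : Str τ} {g : N →[τ] P} {f : M →[τ] N} (hg : K.IsEmb g)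
    (hf : K.IsEmb f) : K.IsEmb (g.comp f) := by
  obtain ⟨N', e, hN, he⟩ := (K.isEmb_iff _).1 hg
  obtain ⟨M', d, hM, hd⟩ := (K.isEmb_iff _).1 hf
  obtain ⟨M'', d', hM', hd'⟩ := K.exists_le_of_equiv hM e
  refine (K.isEmb_iff _).2 ⟨M'', d'.comp d, K.le_trans hM' hN, fun x => ?_⟩
  have hx : (d x : ZFSet.{w}) ∈ N.U := (K.isSub_of_le hM).1 (d x).2
  have : (⟨d x, hx⟩ : N) = f x := Subtype.ext (hd x)
  simp [hd' _ hx, this, he]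

theorem isEmb_equiv {M N : Str τ} (hM : K.mem M) (e : M ≃[τ] N) : K.IsEmb e.toHom :=
  (K.isEmb_iff _).2 ⟨N, e, K.le_refl (K.mem_of_equiv hM e), fun _ => rfl⟩

/-- Coherence for embeddings: an embedding in `N` with range in some `D ≤ N` is one in `D`. -/
theorem IsEmb.codRestrict {B D N : Str τ} {f : B →[τ] N} (hf : K.IsEmb f) (hD : K.le D N)
    (h : ∀ x, (f x : ZFSet.{w}) ∈ D.U) :
    ∃ f' : B →[τ] D, K.IsEmb f' ∧ ∀ x, (f' x : ZFSet.{w}) = f x := by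
  obtain ⟨B', e, hB, he⟩ := (K.isEmb_iff _).1 hf
  have hsub : B'.U ⊆ D.U := fun x hx => by
    obtain ⟨y, hy⟩ := e.surjective ⟨x, hx⟩
    have : (e y : ZFSet.{w}) = x := by rw [hy]
    rw [← this, he]
    exact h y
  have hle : K.le B' D := K.coherence (mem_left hB) (mem_left hD) (mem_right hD) hsub hD hB
  refine ⟨(incl hle).comp e.toHom, (isEmb_incl hle).comp
    (isEmb_equiv (K.mem_of_equiv (mem_left hB) e.symm) e), fun x => ?_⟩
  simp [he]

/-- Every embedding is, up to an isomorphism of its target, an inclusion. -/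
theorem IsEmb.exists_le {A B : Str τ} {f : A →[τ] B} (hf : K.IsEmb f) :
    ∃ (B' : Str τ) (e : B ≃[τ] B'), K.le A B' ∧ ∀ x, (e (f x) : ZFSet.{w}) = x := by
  classical
  obtain ⟨A', d, hA, hd⟩ := (K.isEmb_iff _).1 hf
  -- Points of the image of `A` get their old names back. Any other `b` is renamed `{A.U, b}`, which
  -- by foundation is not an element of `A.U`.
  let j : B → ZFSet.{w} := fun b =>
    if h : (b : ZFSet.{w}) ∈ A'.U then d.symm ⟨b, h⟩ else {A.U, (b : ZFSet.{w})}
  have hnot : ∀ b : ZFSet.{w}, ({A.U, b} : ZFSet.{w}) ∉ A.U := fun b hb =>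
    ZFSet.mem_asymm hb (by simp)
  have hj : Function.Injective j := by
    intro b c hbc
    simp only [j] at hbc
    split_ifs at hbc with h1 h2 h2
    · have := d.symm.injective (Subtype.ext hbc)
      exact Subtype.ext (congrArg (fun z : A' => (z : ZFSet.{w})) this)
    · exact absurd (hbc ▸ (d.symm ⟨b, h1⟩).2) (hnot c)
    · exact absurd (hbc ▸ (d.symm ⟨c, h2⟩).2) (hnot b)
    · apply Subtype.ext
      have hb : (b : ZFSet.{w}) ∈ ({A.U, (c : ZFSet.{w})} : ZFSet.{w}) := hbc ▸ by simp
      have hc : (c : ZFSet.{w}) ∈ ({A.U, (b : ZFSet.{w})} : ZFSet.{w}) := hbc ▸ by simp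
      rw [ZFSet.mem_pair] at hb hc
      rcases hb with hb | hb
      · rcases hc with hc | hc
        · rw [hb, hc]
        · exact hc.symm
      · exact hb
  obtain ⟨A'', e, hle, he⟩ := K.exists_le_of_equiv hA (B.imageEquiv j hj)
  have key : ∀ x : A, j (f x) = x := fun x => by
    have h : (f x : ZFSet.{w}) ∈ A'.U := hd x ▸ (d x).2
    have h2 : (⟨f x, h⟩ : A') = d x := Subtype.ext (hd x).symm
    simp [j, h, h2]
  refine ⟨_, B.imageEquiv j hj, ?_, fun x => key x⟩
  have : A = A'' := Str.eq_of_equiv (e.comp d) fun x => by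
    have hx : (d x : ZFSet.{w}) ∈ B.U := (K.isSub_of_le hA).1 (d x).2
    have h2 : (⟨d x, hx⟩ : B) = f x := Subtype.ext (hd x)
    simp [he _ hx, h2, key]
  rwa [this]

theorem eq_of_le_of_subset {M N : Str τ} (h : K.le M N) (hU : N.U ⊆ M.U) : M = N :=
  K.le_antisymm h (K.coherence (mem_right h) (mem_left h) (mem_right h) hU h
    (K.le_refl (mem_right h)))

variable (K) in
/-- `L` and `R` are small strong extensions of `A` that cannot be amalgamated over `A`. -/
def IsSplit (lam : Cardinal.{w}) (A L R : Str τ) : Prop :=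
  K.le A L ∧ K.le A R ∧ K.MemLT lam L ∧ K.MemLT lam R ∧
    ∀ (D : Str τ) (f : L →[τ] D) (g : R →[τ] D), K.MemLT lam D → K.IsEmb f → K.IsEmb g →
      ¬ ∀ (x : ZFSet.{w}) (hl : x ∈ L.U) (hr : x ∈ R.U), x ∈ A.U → f ⟨x, hl⟩ = g ⟨x, hr⟩

theorem exists_isSplit {lam : Cardinal.{w}} {A : Str τ} (hA : K.MemLT lam A)
    (h : ¬ K.IsAmalgamationBase lam A) : ∃ L R, K.IsSplit lam A L R := by
  simp only [IsAmalgamationBase, not_and, not_forall] at h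
  obtain ⟨B, C, f, g, hB, hC, hf, hg, hno⟩ := h hA
  obtain ⟨L, e, hL, he⟩ := hf.exists_le
  obtain ⟨R, d, hR, hd⟩ := hg.exists_le
  refine ⟨L, R, hL, hR, ⟨mem_right hL, (Str.card_eq_of_equiv e).symm.trans_lt hB.2⟩,
    ⟨mem_right hR, (Str.card_eq_of_equiv d).symm.trans_lt hC.2⟩, fun D f' g' hD hf' hg' hfg => ?_⟩
  refine hno ⟨D, f'.comp e.toHom, g'.comp d.toHom, hD, hf'.comp (isEmb_equiv hB.1 e),
    hg'.comp (isEmb_equiv hC.1 d), ?_⟩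
  ext x
  have h1 : e (f x) = ⟨x, (K.isSub_of_le hL).1 x.2⟩ := Subtype.ext (he x)
  have h2 : d (g x) = ⟨x, (K.isSub_of_le hR).1 x.2⟩ := Subtype.ext (hd x)
  have := hfg x ((K.isSub_of_le hL).1 x.2) ((K.isSub_of_le hR).1 x.2) x.2
  simp [h1, h2, this]

theorem IsSplit.symm {lam : Cardinal.{w}} {A L R : Str τ} (h : K.IsSplit lam A L R) :
    K.IsSplit lam A R L :=
  ⟨h.2.1, h.1, h.2.2.2.1, h.2.2.1, fun D f g hD hf hg hfg =>
    h.2.2.2.2 D g f hD hg hf fun x hl hr hx => (hfg x hr hl hx).symm⟩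

/-- Otherwise `L = A`, and `R` itself amalgamates the two sides. This is what makes branches grow to
size `lam`. -/
theorem IsSplit.not_subset {lam : Cardinal.{w}} {A L R : Str τ} (h : K.IsSplit lam A L R) :
    ¬ L.U ⊆ A.U := by
  intro hU
  have hAL := eq_of_le_of_subset h.1 hU
  subst hAL
  have hid : K.IsEmb (incl (K.le_refl h.2.2.2.1.1)) := isEmb_incl _
  exact h.2.2.2.2 R (incl h.2.1) (incl (K.le_refl h.2.2.2.1.1)) h.2.2.2.1 (isEmb_incl _) hid
    fun x hl hr hx => Subtype.ext (by simp)

theorem isLST_LS : K.IsLST K.LS := csInf_mem K.exists_isLST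

/-- The two sides of a split have no embeddings in a common model that agree on the base. -/
theorem IsSplit.false_of_isEmb {lam : Cardinal.{w}} (hLS : K.LS < lam) {A L R N : Str τ}
    (h : K.IsSplit lam A L R) {f : L →[τ] N} {g : R →[τ] N} (hf : K.IsEmb f) (hg : K.IsEmb g)
    (hfg : ∀ (x : ZFSet.{w}) (hl : x ∈ L.U) (hr : x ∈ R.U), x ∈ A.U →
      f ⟨x, hl⟩ = g ⟨x, hr⟩) : False := by
  have hinf : ℵ₀ ≤ lam := (le_add_self.trans isLST_LS.1).trans hLS.le
  obtain ⟨L', e, hL, he⟩ := (K.isEmb_iff _).1 hf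
  obtain ⟨R', d, hR, hd⟩ := (K.isEmb_iff _).1 hg
  -- `N` may be too large to be an amalgam in `K_{<lam}`, so it is replaced by a small `D ≤ N`
  -- around both images.
  obtain ⟨D, hD, hDN, hsub, hcard⟩ := isLST_LS.2 N (mem_right hL) (L'.U ∪ R'.U) (fun x hx =>
    (ZFSet.mem_union.1 hx).elim (fun h => (K.isSub_of_le hL).1 h) fun h => (K.isSub_of_le hR).1 h)
  have hDlt : D.card < lam := by
    refine hcard.trans_lt (Cardinal.add_lt_of_lt hinf (ZFSet.card_union_le.trans_lt
      (Cardinal.add_lt_of_lt hinf ?_ ?_)) hLS)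
    · exact (Str.card_eq_of_equiv e).symm.trans_lt h.2.2.1.2
    · exact (Str.card_eq_of_equiv d).symm.trans_lt h.2.2.2.1.2
  obtain ⟨f', hf', hff⟩ := hf.codRestrict hDN fun x =>
    hsub (ZFSet.mem_union.2 (Or.inl (he x ▸ (e x).2)))
  obtain ⟨g', hg', hgg⟩ := hg.codRestrict hDN fun x =>
    hsub (ZFSet.mem_union.2 (Or.inr (hd x ▸ (d x).2)))
  exact h.2.2.2.2 D f' g' ⟨hD, hDlt⟩ hf' hg' fun x hl hr hx => Subtype.ext (by
    rw [hff, hgg, hfg x hl hr hx])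

end AEC

/-! ### The tree of models -/

open Classical in
/-- The union of a family of structures if it exists, and the default value `A` otherwise. -/
noncomputable def Str.unionOr {τ : FirstOrder.Language.{w, w}} (A : Str τ) {I : Type w}
    (M : I → Str τ) : Str τ :=
  if h : ∃ N, Str.IsUnion M N then h.choose else A

namespace AEC

variable {τ : FirstOrder.Language.{w, w}} (K : AEC τ) (lam : Cardinal.{w}) (A : Str τ)

open Classical in
/-- The extension of `B` chosen by the bit `b`: one of the two sides of a split of `B`. -/
noncomputable def side (B : Str τ) (b : Bool) : Str τ :=
  if h : ∃ L R, K.IsSplit lam B L R then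
    (if b then h.choose else h.choose_spec.choose) else B

/-- The binary tree of models with root `A` which takes unions at limits and which splits at
every node that is not an amalgamation base. -/
noncomputable def tree (η : Ordinal.{w} → Bool) (δ : Ordinal.{w}) : Str τ :=
  δ.limitRecOn A (fun α B => K.side lam B (η α))
    (fun δ _ ih => Str.unionOr A fun x : δ.ToType => ih (Ordinal.ToType.mk.symm x)
      (Ordinal.ToType.mk.symm x).2)

theorem tree_zero (η : Ordinal.{w} → Bool) : K.tree lam A η 0 = A :=
  Ordinal.limitRecOn_zero ..

theorem tree_add_one (η : Ordinal.{w} → Bool) (δ : Ordinal.{w}) :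
    K.tree lam A η (δ + 1) = K.side lam (K.tree lam A η δ) (η δ) :=
  Ordinal.limitRecOn_add_one ..

theorem tree_limit (η : Ordinal.{w} → Bool) {δ : Ordinal.{w}} (hδ : Order.IsSuccLimit δ) :
    K.tree lam A η δ = Str.unionOr A fun x : δ.ToType =>
      K.tree lam A η (Ordinal.ToType.mk.symm x) :=
  Ordinal.limitRecOn_limit _ _ _ _ hδ

theorem tree_congr {η ν : Ordinal.{w} → Bool} {δ : Ordinal.{w}} (h : ∀ α < δ, η α = ν α) :
    K.tree lam A η δ = K.tree lam A ν δ := by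
  induction δ using Ordinal.limitRecOn with
  | zero => rw [tree_zero, tree_zero]
  | add_one δ ih =>
    rw [tree_add_one, tree_add_one, ih fun α hα => h α (hα.trans (lt_add_one δ)),
      h δ (lt_add_one δ)]
  | limit δ hδ ih =>
    rw [tree_limit K lam A η hδ, tree_limit K lam A ν hδ]
    congr 1
    funext x
    have hx : (Ordinal.ToType.mk.symm x : Ordinal) < δ := (Ordinal.ToType.mk.symm x).2
    exact ih _ hx fun α hα => h α (hα.trans hx)

variable {K lam A}

theorem isSplit_side {B : Str τ} (h : ∃ L R, K.IsSplit lam B L R) {b c : Bool} (hbc : b ≠ c) :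
    K.IsSplit lam B (K.side lam B b) (K.side lam B c) := by
  have hs := h.choose_spec.choose_spec
  cases b <;> cases c <;> simp only [ne_eq, not_true_eq_false, reduceCtorEq,
    not_false_eq_true] at hbc <;> simp only [side, dif_pos h]
  · exact hs.symm
  · exact hs

section Tree

variable (hreg : lam.IsRegular) (hA : K.MemLT lam A)
  (hsplit : ∀ N, K.MemLT lam N → K.le A N → ∃ L R, K.IsSplit lam N L R) (η : Ordinal.{w} → Bool)

theorem isUnion_tree {δ : Ordinal.{w}} (hδ : Order.IsSuccLimit δ)
    (h : ∀ β < δ, ∀ α ≤ β, K.le (K.tree lam A η α) (K.tree lam A η β)) :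
    Str.IsUnion (fun x : δ.ToType => K.tree lam A η (Ordinal.ToType.mk.symm x))
      (K.tree lam A η δ) := by
  have : Nonempty δ.ToType := Ordinal.nonempty_toType_iff.2 hδ.ne_bot
  have hex := Str.exists_isUnion (fun x : δ.ToType => K.tree lam A η (Ordinal.ToType.mk.symm x))
    fun x y hxy => K.isSub_of_le (h _ (Ordinal.ToType.mk.symm y).2 _
      (Ordinal.ToType.mk.symm.monotone hxy))
  rw [tree_limit K lam A η hδ, Str.unionOr, dif_pos hex]
  exact hex.choose_spec

theorem card_le_sum_of_isUnion {I : Type w} {M : I → Str τ} {N : Str τ} (h : Str.IsUnion M N) :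
    N.card ≤ Cardinal.sum fun i => (M i).card := by
  have hU : N.U = ZFSet.iUnion fun i => (M i).U := by
    ext x
    rw [h.mem_iff, ZFSet.mem_iUnion]
  have := ZFSet.lift_card_iUnion_le_sum_card (f := fun i => (M i).U)
  rw [← hU, Cardinal.lift_id] at this
  exact this

include hreg hA hsplit

/-- Both claims go in one induction: a node must be small and above the root for it to split.
Regularity of `lam` keeps unions at limits below `lam` small; the union at `lam.ord` is not, hence
the guard. -/
theorem tree_aux {δ : Ordinal.{w}} (hδ : δ ≤ lam.ord) :
    (∀ α ≤ δ, K.le (K.tree lam A η α) (K.tree lam A η δ)) ∧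
      (δ < lam.ord → (K.tree lam A η δ).card < lam) := by
  induction δ using Ordinal.limitRecOn with
  | zero =>
    refine ⟨fun α hα => ?_, fun _ => ?_⟩
    · rw [nonpos_iff_eq_zero.1 hα, tree_zero]
      exact K.le_refl hA.1
    · rw [tree_zero]
      exact hA.2
  | add_one δ ih =>
    have hlt : δ < lam.ord := (lt_add_one δ).trans_le hδ
    obtain ⟨h1, h2⟩ := ih hlt.le
    have hroot : K.le A (K.tree lam A η δ) := by
      simpa only [tree_zero] using h1 0 (zero_le)
    have hs := isSplit_side (hsplit _ ⟨mem_right hroot, h2 hlt⟩ hroot)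
      (Bool.self_ne_not (η δ))
    rw [← tree_add_one] at hs
    refine ⟨fun α hα => ?_, fun _ => hs.2.2.1.2⟩
    rcases hα.lt_or_eq with hα | rfl
    · exact K.le_trans (h1 α (Order.lt_add_one_iff.1 hα)) hs.1
    · exact K.le_refl hs.2.2.1.1
  | limit δ hlim ih =>
    have hU := isUnion_tree η hlim fun β hβ => (ih β hβ (hβ.le.trans hδ)).1
    have : Nonempty δ.ToType := Ordinal.nonempty_toType_iff.2 hlim.ne_bot
    have hx : ∀ x : δ.ToType, (Ordinal.ToType.mk.symm x : Ordinal) < δ :=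
      fun x => (Ordinal.ToType.mk.symm x).2
    obtain ⟨hmem, hle, -⟩ := K.tarski_vaught _
      (fun x => mem_left ((ih _ (hx x) ((hx x).le.trans hδ)).1 _ le_rfl))
      (fun x y hxy => (ih _ (hx y) ((hx y).le.trans hδ)).1 _
        (Ordinal.ToType.mk.symm.monotone hxy)) _ hU
    refine ⟨fun α hα => ?_, fun hlt => ?_⟩
    · rcases hα.lt_or_eq with hα | rfl
      · simpa using hle (Ordinal.ToType.mk ⟨α, hα⟩)
      · exact K.le_refl hmem
    · refine (card_le_sum_of_isUnion hU).trans_lt (Cardinal.sum_lt_of_isRegular hreg ?_ ?_)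
      · simpa using Cardinal.lt_ord.1 hlt
      · exact fun x => (ih _ (hx x) ((hx x).le.trans hδ)).2 ((hx x).trans hlt)

theorem tree_le {α δ : Ordinal.{w}} (hα : α ≤ δ) (hδ : δ ≤ lam.ord) :
    K.le (K.tree lam A η α) (K.tree lam A η δ) :=
  (tree_aux hreg hA hsplit η hδ).1 α hα

theorem tree_subset {α δ : Ordinal.{w}} (hα : α ≤ δ) (hδ : δ ≤ lam.ord) :
    (K.tree lam A η α).U ⊆ (K.tree lam A η δ).U :=
  (K.isSub_of_le (tree_le hreg hA hsplit η hα hδ)).1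

theorem card_tree_lt {δ : Ordinal.{w}} (hδ : δ < lam.ord) : (K.tree lam A η δ).card < lam :=
  (tree_aux hreg hA hsplit η hδ.le).2 hδ

theorem mem_tree_limit_iff {δ : Ordinal.{w}} (hδ : δ ≤ lam.ord) (hlim : Order.IsSuccLimit δ)
    {x : ZFSet.{w}} : x ∈ (K.tree lam A η δ).U ↔ ∃ α < δ, x ∈ (K.tree lam A η α).U := by
  rw [(isUnion_tree η hlim fun β hβ α hα =>
    tree_le hreg hA hsplit η hα (hβ.le.trans hδ)).mem_iff]
  constructor
  · rintro ⟨y, hy⟩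
    exact ⟨_, (Ordinal.ToType.mk.symm y).2, hy⟩
  · rintro ⟨α, hα, hx⟩
    exact ⟨Ordinal.ToType.mk ⟨α, hα⟩, by simpa using hx⟩

theorem exists_isSplit_tree {δ : Ordinal.{w}} (hδ : δ < lam.ord) :
    ∃ L R, K.IsSplit lam (K.tree lam A η δ) L R := by
  have h := tree_le hreg hA hsplit η (zero_le (a := δ)) hδ.le
  rw [tree_zero] at h
  exact hsplit _ ⟨mem_right h, card_tree_lt hreg hA hsplit η hδ⟩ h

theorem card_tree_ord : (K.tree lam A η lam.ord).card = lam := by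
  have hlim : Order.IsSuccLimit lam.ord := Cardinal.isSuccLimit_ord hreg.aleph0_le
  apply _root_.le_antisymm
  · refine (card_le_sum_of_isUnion (isUnion_tree η hlim fun β hβ α hα =>
      tree_le hreg hA hsplit η hα hβ.le)).trans ?_
    refine (Cardinal.sum_le_sum _ (fun _ => lam) fun x =>
      (card_tree_lt hreg hA hsplit η (Ordinal.ToType.mk.symm x).2).le).trans ?_
    simp [Cardinal.mul_eq_self hreg.aleph0_le]
  -- Each split adds a point, and points added at different heights are distinct.
  · have hnew : ∀ δ : Set.Iio lam.ord, ∃ x, x ∈ (K.tree lam A η (δ + 1)).U ∧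
        x ∉ (K.tree lam A η δ).U := by
      rintro ⟨δ, hδ⟩
      have hs := isSplit_side (exists_isSplit_tree hreg hA hsplit η hδ)
        (Bool.self_ne_not (η δ))
      rw [← tree_add_one] at hs
      by_contra! h
      exact hs.not_subset h
    choose x hx hx' using hnew
    have hinj : Function.Injective x := by
      have key : ∀ α β : Set.Iio lam.ord, α < β → x α ≠ x β := fun α β hlt heq =>
        hx' β (heq ▸ tree_subset hreg hA hsplit η (Order.add_one_le_of_lt hlt)
          (le_of_lt β.2) (hx α))
      intro α β h
      rcases lt_trichotomy α β with hlt | rfl | hlt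
      · exact absurd h (key _ _ hlt)
      · rfl
      · exact absurd h.symm (key _ _ hlt)
    let F : Set.Iio lam.ord → (K.tree lam A η lam.ord).U := fun δ =>
      ⟨x δ, tree_subset hreg hA hsplit η (hlim.succ_lt δ.2).le le_rfl (hx δ)⟩
    have hF : Function.Injective F := fun α β h => hinj (congrArg Subtype.val h)
    have := Cardinal.mk_le_of_injective hF
    rw [Cardinal.mk_Iio_ordinal, ZFSet.cardinalMk_coe_sort, Cardinal.lift_le,
      Cardinal.card_ord] at this
    exact this

end Tree

end AEC

/-! ### Coding branches by their embeddings -/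

theorem sigma_fun_eq_iff {β : Type*} {Y : Type*} {P : β → ZFSet.{w}} {ρ σ : β}
    {f : P ρ → Y} {g : P σ → Y} :
    (⟨ρ, f⟩ : Σ ρ, P ρ → Y) = ⟨σ, g⟩ ↔ ρ = σ ∧ ∀ x hx hy, f ⟨x, hx⟩ = g ⟨x, hy⟩ := by
  constructor
  · intro h
    cases h
    exact ⟨rfl, fun _ _ _ => rfl⟩
  · rintro ⟨rfl, h⟩
    congr 1
    funext x
    exact h x x.2 x.2

namespace AEC

variable {τ : FirstOrder.Language.{w, w}} {K : AEC τ} {lam : Cardinal.{w}} {A : Str τ}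

open Classical in
/-- Extension by `false` of a branch of height `δ`. -/
noncomputable def extendBranch {δ : Ordinal.{w}} (ρ : Set.Iio δ → Bool) : Ordinal.{w} → Bool :=
  fun α => if h : α < δ then ρ ⟨α, h⟩ else false

/-- Nodes of height `δ` can thus be indexed by the bits below `δ`, which makes them countable by
cardinals of the small universe. -/
theorem tree_extendBranch (η : Ordinal.{w} → Bool) (δ : Ordinal.{w}) :
    K.tree lam A (extendBranch fun α : Set.Iio δ => η α) δ = K.tree lam A η δ :=
  tree_congr K lam A fun α hα => by simp [extendBranch, hα]

/-- There are at most `2 ^ θ = 2 ^< lam` pairs of a node `ρ` of height `δ < lam` and a map from the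
model at `ρ` to a model of cardinality `lam`. -/
theorem mk_sigma_tree_le {θ : Cardinal.{w}} (hlam : ℵ₀ ≤ lam) (hθ : θ < lam) (hθ' : ℵ₀ ≤ θ)
    (h1 : (2 : Cardinal.{w}) ^ θ = 2 ^< lam) {N : Str τ} (hN : N.card = lam) {δ : Ordinal.{w}}
    (hδ : δ < lam.ord) (hcard : ∀ η, (K.tree lam A η δ).card < lam) :
    #(Σ ρ : Set.Iio δ → Bool, (K.tree lam A (extendBranch ρ) δ → N)) ≤
      Cardinal.lift.{w + 1} ((2 : Cardinal.{w}) ^ θ) := by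
  have hfun : ∀ ρ : Set.Iio δ → Bool, #(K.tree lam A (extendBranch ρ) δ → N) ≤
      Cardinal.lift.{w + 1} ((2 : Cardinal.{w}) ^ θ) := by
    intro ρ
    rw [← Cardinal.power_def, ZFSet.cardinalMk_coe_sort, ZFSet.cardinalMk_coe_sort,
      ← Cardinal.lift_power, Cardinal.lift_le]
    have hN' : N.U.card ≤ 2 ^ θ := by
      rw [h1]
      exact hN.trans_le (le_two_powerlt lam)
    calc N.U.card ^ (K.tree lam A (extendBranch ρ) δ).U.card
        ≤ ((2 : Cardinal.{w}) ^ θ) ^ (K.tree lam A (extendBranch ρ) δ).U.card :=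
          Cardinal.power_le_power_right hN'
      _ = 2 ^ (θ * (K.tree lam A (extendBranch ρ) δ).U.card) := Cardinal.power_mul.symm
      _ ≤ 2 ^< lam := Cardinal.le_powerlt _ (Cardinal.mul_lt_of_lt hlam hθ (hcard _))
      _ = 2 ^ θ := h1.symm
  have hδ' : (2 : Cardinal.{w}) ^ δ.card ≤ 2 ^ θ := by
    rw [h1]
    exact Cardinal.le_powerlt _ (Cardinal.lt_ord.1 hδ)
  have hinf : ℵ₀ ≤ (2 : Cardinal.{w}) ^ θ := hθ'.trans (Cardinal.cantor θ).le
  rw [Cardinal.mk_sigma]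
  refine (Cardinal.sum_le_sum _ _ hfun).trans ?_
  have hbits : #(Set.Iio δ → Bool) = Cardinal.lift.{w + 1} ((2 : Cardinal.{w}) ^ δ.card) := by
    simp [Cardinal.mk_Iio_ordinal]
  rw [Cardinal.sum_const', hbits, ← Cardinal.lift_mul, Cardinal.lift_le]
  exact (mul_le_mul_left hδ' _).trans_eq (Cardinal.mul_eq_self hinf)

/-- A root above which every node splits contradicts the existence of a universal model. -/
theorem false_of_forall_isSplit {θ : Cardinal.{w}} (hLS : K.LS < lam) (hθ : θ < lam)
    (h1 : (2 : Cardinal.{w}) ^ θ = 2 ^< lam) (h2 : (2 : Cardinal.{w}) ^< lam < 2 ^ lam)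
    {N : Str τ} (hN : K.IsUniversal lam N) (hA : K.MemLT lam A)
    (hsplit : ∀ B, K.MemLT lam B → K.le A B → ∃ L R, K.IsSplit lam B L R) : False := by
  have hlam' : ℵ₀ < lam := (le_add_self.trans isLST_LS.1).trans_lt hLS
  have hlam := hlam'.le
  have hreg := isRegular_of_two_power_eq_powerlt hlam hθ h1 h2
  have hθ' := aleph0_le_of_two_power_eq_powerlt hlam' h1
  have hemb : ∀ η, ∃ f : K.tree lam A η lam.ord →[τ] N, K.IsEmb f := fun η =>
    hN.2 _ ⟨mem_left (tree_le hreg hA hsplit η le_rfl le_rfl), card_tree_ord hreg hA hsplit η⟩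
  choose f hf using hemb
  have hsub : ∀ η {δ : Ordinal.{w}}, δ < lam.ord →
      (K.tree lam A η δ).U ⊆ (K.tree lam A η lam.ord).U :=
    fun η δ hδ => tree_subset hreg hA hsplit η hδ.le le_rfl
  let code : ∀ (η : Ordinal.{w} → Bool) {δ : Ordinal.{w}}, δ < lam.ord →
      Σ ρ : Set.Iio δ → Bool, (K.tree lam A (extendBranch ρ) δ → N) := fun η δ hδ =>
    ⟨fun α => η α, fun x => f η ⟨x, hsub η hδ (tree_extendBranch (K := K) η δ ▸ x.2)⟩⟩
  have code_eq : ∀ η ν {δ : Ordinal.{w}} (hδ : δ < lam.ord), code η hδ = code ν hδ ↔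
      (∀ α < δ, η α = ν α) ∧ ∀ x hx hy, x ∈ (K.tree lam A η δ).U →
        f η ⟨x, hx⟩ = f ν ⟨x, hy⟩ := by
    intro η ν δ hδ
    refine (sigma_fun_eq_iff (P := fun ρ => (K.tree lam A (extendBranch ρ) δ).U)).trans ?_
    constructor
    · rintro ⟨hη, h⟩
      have hη' : ∀ α < δ, η α = ν α := fun α hα => congrFun hη ⟨α, hα⟩
      refine ⟨hη', fun x hx hy hxδ => h x ?_ ?_⟩
      · rwa [tree_extendBranch]
      · rwa [tree_extendBranch, ← tree_congr K lam A hη']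
    · rintro ⟨hη, h⟩
      refine ⟨funext fun α => hη α α.2, fun x hx hy => h x _ _ ?_⟩
      rwa [tree_extendBranch] at hx
  have hE : ∀ {δ : Ordinal.{w}}, δ < lam.ord →
      Nonempty ((Σ ρ : Set.Iio δ → Bool, (K.tree lam A (extendBranch ρ) δ → N)) ↪
        (θ.out → Bool)) := by
    intro δ hδ
    have hout : #(θ.out → Bool) = 2 ^ θ := by simp
    rw [← Cardinal.lift_mk_le', Cardinal.lift_id'.{w, w + 1}, hout]
    exact mk_sigma_tree_le hlam hθ hθ' h1 hN.1.2 hδ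
      fun η => card_tree_lt hreg hA hsplit η hδ
  have hinf : Infinite θ.out := Cardinal.infinite_iff.2 (by simpa using hθ')
  classical
  let c : (Ordinal.{w} → Bool) → Ordinal.{w} → θ.out → Bool := fun η δ =>
    if hδ : δ < lam.ord then (hE hδ).some (code η hδ) else fun _ => false
  have c_eq : ∀ η ν {δ : Ordinal.{w}}, δ < lam.ord → (c η δ = c ν δ ↔
      (∀ α < δ, η α = ν α) ∧ ∀ x hx hy, x ∈ (K.tree lam A η δ).U →
        f η ⟨x, hx⟩ = f ν ⟨x, hy⟩) := by
    intro η ν δ hδ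
    rw [← code_eq η ν hδ]
    simp only [c, dif_pos hδ]
    exact (hE hδ).some.injective.eq_iff
  have hlim0 : Order.IsSuccLimit lam.ord := Cardinal.isSuccLimit_ord hlam
  have hle := two_power_le_of_predictor hlam c ?_ ?_
  · rw [Cardinal.mk_out, h1] at hle
    exact hle.not_gt h2
  · intro η ν δ hδ hc
    obtain ⟨hη, hfx⟩ := (c_eq η ν hδ).1 hc
    -- Both branches pass through the same node at `δ`, so with different bits their nodes at `δ +
    -- 1` are the two sides of its split. The maps `f η` and `f ν` agree on the base.
    by_contra hne
    have hs := isSplit_side (exists_isSplit_tree hreg hA hsplit η hδ) hne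
    rw [← tree_add_one, tree_congr K lam A hη, ← tree_add_one] at hs
    have hδ1 : δ + 1 ≤ lam.ord := (hlim0.succ_lt hδ).le
    refine hs.false_of_isEmb hLS
      ((hf η).comp (isEmb_incl (tree_le hreg hA hsplit η hδ1 le_rfl)))
      ((hf ν).comp (isEmb_incl (tree_le hreg hA hsplit ν hδ1 le_rfl))) fun x hl hr hx => ?_
    rw [← tree_congr K lam A hη] at hx
    have e1 : incl (tree_le hreg hA hsplit η hδ1 le_rfl) ⟨x, hl⟩ = ⟨x, hsub η hδ hx⟩ :=
      Subtype.ext (coe_incl _ _)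
    have e2 : incl (tree_le hreg hA hsplit ν hδ1 le_rfl) ⟨x, hr⟩ =
        ⟨x, tree_subset hreg hA hsplit ν hδ1 le_rfl hr⟩ := Subtype.ext (coe_incl _ _)
    simp only [Language.Hom.comp_apply, e1, e2]
    exact hfx x _ _ hx
  · intro η ν δ hδ hlim h
    refine (c_eq η ν hδ).2 ⟨fun α hα => ?_, fun x hx hy hxδ => ?_⟩
    -- The code at `α` only sees bits strictly below `α`, so bit `α` is read off at `α + 1`.
    · have hα1 : α + 1 < δ := hlim.succ_lt hα
      exact ((c_eq η ν (hα1.trans hδ)).1 (h _ hα1)).1 α (lt_add_one α)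
    · obtain ⟨α, hα, hxα⟩ := (mem_tree_limit_iff hreg hA hsplit η hδ.le hlim).1 hxδ
      exact ((c_eq η ν (hα.trans hδ)).1 (h α hα)).2 x hx hy hxα

end AEC

theorem mainTheorem8 (τ : FirstOrder.Language.{w, w}) (K : AEC τ) (lam : Cardinal.{w}) (hLS : K.LS < lam)
    (hlam : ∃ θ : Cardinal.{w}, θ < lam ∧
      (2 : Cardinal.{w}) ^ θ = 2 ^< lam ∧ (2 : Cardinal.{w}) ^< lam < 2 ^ lam)
    (huniv : ∃ N : Str τ, K.IsUniversal lam N) :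
    ∀ M : Str τ, K.MemLT lam M →
      ∃ N : Str τ, K.MemLT lam N ∧ K.le M N ∧ K.IsAmalgamationBase lam N := by
  intro M hM
  obtain ⟨θ, hθ, h1, h2⟩ := hlam
  obtain ⟨U, hU⟩ := huniv
  by_contra! h
  exact AEC.false_of_forall_isSplit hLS hθ h1 h2 hU hM fun B hB hMB =>
    AEC.exists_isSplit hB (h B hB hMB)
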